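/- All graphs are finite and simple; the order of a graph is its number of vertices and its size is its number of edges. Let $C_4$ denote the cycle of length $4$. A copy of $C_4$ in a graph $G$ is a (not necessarily induced) subgraph of $G$ that is isomorphic to $C_4$, and $\mathrm{ex}(n, C_4)$ denotes the maximum size of a graph of order $n$ that contains no copy of $C_4$. For every integer $n$ with $6 \le n \le 11$ there exists a graph of order $n$ and size $\mathrm{ex}(n, C_4)+1$ which contains exactly one copy of $C_4$. For $n = 12$ and for $n = 13$, the minimum number of copies of $C_4$ in a graph of order $n$ and size $\mathrm{ex}(n, C_4)+1$ is $2$. -/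

import Mathlib

open Finset

/-! ### Exhaustive search for graphs without 4-cycles

A partial graph on a list of named vertices is stored as the list of adjacency bit masks of these
vertices, together with lower bounds for the number of their neighbours that are not named yet. -/

/-! Upper bounds on ex(n, C₄) go by induction on n. Deleting a vertex v from a C₄-free graph that is
too large would leave one too large on n − 1 vertices unless v has large degree. So the minimum
degree is large: either this contradicts the average degree, or a finite search rules the graph out.
The search grows the graph vertex by vertex, using that two neighbours of a new vertex have no
common neighbour among the old ones.

For n ≤ 11 an explicit graph has one edge more than the bound and a single C₄. Deleting an edge of
it shows that the bound is ex(n, C₄).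

For n = 12, suppose 22 edges and at most one C₄. As ex(12, C₄) ≤ 21, there is one. Deleting a vertex
on it, or an edge of it and any vertex, leaves a C₄-free graph of order 11, hence at most 18 edges.
So degrees are at least 4 on the cycle and 3 everywhere, and a search starting from the cycle
refutes this. For n = 13, deleting a vertex of small degree reduces to n = 12. Explicit graphs with
two copies sharing an edge attain the minimum. -/

/-- Checks `k bs` for all selections `bs` of pairwise disjoint masks that are also disjoint from
`A`. If `p` is positive, then only selections containing the `p`-th mask are considered. -/
def allSelections : List ℕ → ℕ → ℕ → (List Bool → Bool) → Bool
  | [], _, _, k => k []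
  | m :: ms, A, p, k =>
    (bif Nat.beq (Nat.land m A) 0 then
      allSelections ms (Nat.lor A m) (Nat.pred p) fun bs => k (true :: bs) else true) &&
    (bif Nat.beq p 1 then true else allSelections ms A (Nat.pred p) fun bs => k (false :: bs))

/-- The (one-based) position of the oldest smallest positive entry below `5`, or `0` if there is
none. -/
def pivotIndex (ds : List ℕ) : ℕ :=
  let t := fun j => ds.reverse.findIdx (Nat.beq j)
  let l := ds.length
  bif Nat.blt (t 1) l then l - t 1 else
  bif Nat.blt (t 2) l then l - t 2 else
  bif Nat.blt (t 3) l then l - t 3 else l - t 4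

/-- The bit mask whose binary digits, lowest first, are the given ones. -/
def bitMask (bs : List Bool) : ℕ := bs.foldr Nat.bit 0

/-- `noExtension d r m ms ds` checks that a partial graph cannot be extended by `r` vertices of
degree at least `d` and by at least `m` edges without a 4-cycle through a new vertex. -/
def noExtension (d : ℕ) : ℕ → ℕ → List ℕ → List ℕ → Bool
  | 0, m, _, ds => ds.any (Nat.blt 0) || Nat.blt 0 m
  | r + 1, m, ms, ds => ds.any (Nat.blt (r + 1)) ||
    allSelections ms 0 (pivotIndex ds) fun bs =>
      noExtension d r (m - bs.count true)
        (Nat.bit false (bitMask bs) :: List.zipWith Nat.bit bs ms)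
        ((d - bs.count true) :: List.zipWith (fun b k => bif b then Nat.pred k else k) bs ds)

/-! ### Soundness of the enumeration and of the pivot -/

theorem allSelections_sound {α : Type*} (g : α → ℕ) (s : α → Bool) (l : List α) (A p : ℕ)
    (k : List Bool → Bool) (h : allSelections (l.map g) A p k = true)
    (hA : ∀ x ∈ l, s x = true → (g x).land A = 0)
    (hl : l.Pairwise fun x y => s x = true → s y = true → (g x).land (g y) = 0)
    (hp : p = 0 ∨ ∃ x, l[p - 1]? = some x ∧ s x = true) :
    k (l.map s) = true := by
  induction l generalizing A p k with
  | nil => simpa [allSelections] using h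
  | cons x l ih =>
    rw [List.pairwise_cons] at hl
    simp only [List.map_cons, allSelections, Bool.and_eq_true] at h
    -- Since `Nat.pred 0 = 0`, the value 0 (no forced entry) persists down the list.
    have hp' : p ≠ 1 → p.pred = 0 ∨ ∃ x, l[p.pred - 1]? = some x ∧ s x = true := by
      intro h1
      rcases p with _ | _ | p
      · simp
      · simp at h1
      · right
        simpa using hp
    by_cases hx : s x = true
    · have h1 := h.1
      have h0 : Nat.beq ((g x).land A) 0 = true := by
        rw [hA x (by simp) hx]; rfl
      rw [h0, cond_true] at h1
      simp only [List.map_cons, hx]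
      by_cases hp1 : p = 1
      · subst hp1
        refine ih _ _ _ h1 (fun y hy sy => ?_) hl.2 (by simp)
        have e1 := hA y (by simp [hy]) sy
        have e2 := hl.1 y hy hx sy
        change g y &&& (A ||| g x) = 0
        change g y &&& A = 0 at e1
        change g x &&& g y = 0 at e2
        rw [Nat.and_or_distrib_left, e1, Nat.and_comm, e2]; rfl
      · refine ih _ _ _ h1 (fun y hy sy => ?_) hl.2 (hp' hp1)
        have e1 := hA y (by simp [hy]) sy
        have e2 := hl.1 y hy hx sy
        change g y &&& (A ||| g x) = 0
        change g y &&& A = 0 at e1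
        change g x &&& g y = 0 at e2
        rw [Nat.and_or_distrib_left, e1, Nat.and_comm, e2]; rfl
    · have hp1 : p ≠ 1 := by
        rintro rfl
        simp at hp
        exact hx hp
      have h2 := h.2
      have h0 : Nat.beq p 1 = false := by
        rw [Bool.eq_false_iff]
        intro h
        exact hp1 (Nat.eq_of_beq_eq_true h)
      rw [h0, cond_false] at h2
      rw [Bool.not_eq_true] at hx
      simp only [List.map_cons, hx]
      exact ih _ _ _ h2 (fun y hy => hA y (by simp [hy])) hl.2 (hp' hp1)

theorem length_sub_findIdx_reverse (ds : List ℕ) (j : ℕ) (hj : 0 < j) :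
    ds.length - ds.reverse.findIdx (Nat.beq j) = 0 ∨
      ∃ k, ds[ds.length - ds.reverse.findIdx (Nat.beq j) - 1]? = some k ∧ 0 < k := by
  by_cases h : ds.reverse.findIdx (Nat.beq j) < ds.reverse.length
  · right
    have h1 := List.findIdx_getElem (w := h)
    have h2 := Nat.eq_of_beq_eq_true h1
    rw [List.getElem_reverse] at h2
    rw [List.length_reverse] at h
    refine ⟨j, ?_, hj⟩
    rw [List.getElem?_eq_some_iff]
    refine ⟨by omega, ?_⟩
    conv_rhs => rw [h2]
    congr 1
    omega
  · left
    rw [List.length_reverse] at h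
    omega

theorem pivotIndex_spec (ds : List ℕ) :
    pivotIndex ds = 0 ∨ ∃ k, ds[pivotIndex ds - 1]? = some k ∧ 0 < k := by
  unfold pivotIndex
  dsimp only
  repeat' (rw [Bool.cond_eq_ite]; split_ifs)
  all_goals exact length_sub_findIdx_reverse _ _ (by norm_num)

namespace SimpleGraph

/-! ### Four-cycles and soundness of the search -/

section

variable {V : Type*} (G : SimpleGraph V)

/-- The vertices `a`, `b`, `c`, `d` form, in this order, a cycle of length four. -/
def IsFourCycle (a b c d : V) : Prop :=
  a ≠ c ∧ b ≠ d ∧ G.Adj a b ∧ G.Adj b c ∧ G.Adj c d ∧ G.Adj d a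

variable [DecidableRel G.Adj]

/-- The adjacencies between a vertex and the vertices of a list. -/
def adjBits (vs : List V) (v : V) : List Bool := vs.map fun u => decide (G.Adj v u)

/-- The number of edges inside a list of distinct vertices. -/
def edgesIn : List V → ℕ
  | [] => 0
  | v :: vs => edgesIn vs + (G.adjBits vs v).count true

theorem adjBits_cons (u v : V) (vs : List V) :
    G.adjBits (u :: vs) v = decide (G.Adj v u) :: G.adjBits vs v := rfl

theorem exists_common_neighbor {vs : List V} {u v : V}
    (h : (bitMask (G.adjBits vs u)).land (bitMask (G.adjBits vs v)) ≠ 0) :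
    ∃ x ∈ vs, G.Adj u x ∧ G.Adj v x := by
  induction vs with
  | nil => exact (h (Nat.zero_and 0)).elim
  | cons x vs ih =>
    by_cases hx : G.Adj u x ∧ G.Adj v x
    · exact ⟨x, by simp, hx⟩
    · obtain ⟨y, hy, h'⟩ := ih (by
        intro h0
        apply h
        change Nat.bit _ (bitMask (G.adjBits vs u)) &&& Nat.bit _ (bitMask (G.adjBits vs v)) = 0
        change bitMask (G.adjBits vs u) &&& bitMask (G.adjBits vs v) = 0 at h0
        rw [Nat.land_bit, h0]
        simpa using hx)
      exact ⟨y, by simp [hy], h'⟩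

theorem sum_count_adjBits_cons (w : V) (vs l : List V) :
    (l.map fun v => (G.adjBits (w :: vs) v).count true).sum =
      (l.map fun v => (G.adjBits vs v).count true).sum + (G.adjBits l w).count true := by
  induction l with
  | nil => rfl
  | cons x l ih =>
    rw [List.map_cons, List.sum_cons, ih, List.map_cons, List.sum_cons, adjBits_cons,
      adjBits_cons, List.count_cons, List.count_cons]
    simp only [G.adj_comm w x]
    omega

theorem sum_count_adjBits (vs : List V) :
    (vs.map fun v => (G.adjBits vs v).count true).sum = 2 * G.edgesIn vs := by
  induction vs with
  | nil => rfl
  | cons w vs ih =>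
    rw [List.map_cons, List.sum_cons, sum_count_adjBits_cons, ih, adjBits_cons, List.count_cons,
      edgesIn]
    simp
    omega

theorem count_adjBits [DecidableEq V] {vs : List V} (h : vs.Nodup) (v : V) :
    (G.adjBits vs v).count true = #{u ∈ vs.toFinset | G.Adj v u} := by
  rw [adjBits, List.count, List.countP_map, List.countP_eq_length_filter,
    ← List.toFinset_card_of_nodup (h.filter _)]
  congr 1
  ext u
  simp

theorem map_bitMask_adjBits_cons (w : V) (vs l : List V) :
    (l.map fun v => bitMask (G.adjBits (w :: vs) v)) =
      List.zipWith Nat.bit (G.adjBits l w) (l.map fun v => bitMask (G.adjBits vs v)) := by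
  induction l with
  | nil => rfl
  | cons v l ih =>
    rw [List.map_cons, ih, adjBits_cons, adjBits_cons, List.map_cons, List.zipWith_cons_cons]
    simp only [G.adj_comm v w]
    rfl

variable [Fintype V] [DecidableEq V]

theorem card_edgeFinset_eq_edgesIn {vs : List V} (h : vs.Nodup) (hV : ∀ v, v ∈ vs) :
    #G.edgeFinset = G.edgesIn vs := by
  have hu : vs.toFinset = univ := by
    ext v
    simp [hV]
  have h1 := G.sum_degrees_eq_twice_card_edges
  have h2 := G.sum_count_adjBits vs
  rw [← List.sum_toFinset _ h, hu] at h2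
  have h3 : ∀ v, G.degree v = (G.adjBits vs v).count true := by
    intro v
    rw [G.count_adjBits h, hu, ← card_neighborFinset_eq_degree, neighborFinset_eq_filter]
  simp_rw [h3, h2] at h1
  omega

/-- The number of neighbours of a vertex outside a list. -/
def outDegree (vs : List V) (v : V) : ℕ := #{u | G.Adj v u ∧ u ∉ vs}

theorem outDegree_cons {vs : List V} {w : V} (hw : w ∉ vs) (v : V) :
    G.outDegree vs v = G.outDegree (w :: vs) v + if G.Adj v w then 1 else 0 := by
  unfold outDegree
  split_ifs with h
  · have h1 : univ.filter (fun u => G.Adj v u ∧ u ∉ vs) =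
        insert w (univ.filter fun u => G.Adj v u ∧ u ∉ w :: vs) := by
      ext u
      by_cases hu : u = w
      · subst hu
        simp [h, hw]
      · simp [hu]
    rw [h1, card_insert_of_notMem (by simp)]
  · congr 1
    ext u
    by_cases hu : u = w
    · subst hu
      simp [h]
    · simp [hu]

theorem degree_eq_outDegree_add {vs : List V} (h : vs.Nodup) (v : V) :
    G.degree v = G.outDegree vs v + (G.adjBits vs v).count true := by
  rw [G.count_adjBits h, outDegree, ← card_neighborFinset_eq_degree, neighborFinset_eq_filter,
    ← card_union_of_disjoint]
  · congr 1
    ext u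
    simp
    tauto
  · refine Finset.disjoint_left.2 fun u hu => ?_
    simp at hu ⊢
    tauto

theorem outDegree_le {r : ℕ} {vs : List V} (hvs : vs.Nodup)
    (hr : Fintype.card V = vs.length + r) (v : V) : G.outDegree vs v ≤ r := by
  have h1 : G.outDegree vs v ≤ #(univ \ vs.toFinset) := by
    refine card_le_card fun u hu => ?_
    simp at hu ⊢
    exact hu.2
  rw [card_sdiff_of_subset (subset_univ _), card_univ, hr,
    List.toFinset_card_of_nodup hvs] at h1
  omega

/-- The pruning test never fires on a genuine graph: only `r` vertices are still unnamed. -/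
theorem any_blt_eq_false {r : ℕ} {vs : List V} {ds : List ℕ} (hvs : vs.Nodup)
    (hr : Fintype.card V = vs.length + r)
    (hds : List.Forall₂ (fun v k => k ≤ G.outDegree vs v) vs ds) : ds.any (Nat.blt r) = false := by
  rw [List.any_eq_false]
  intro k hk hlt
  obtain ⟨i, hi, rfl⟩ := List.getElem_of_mem hk
  have h1 := (List.forall₂_iff_get.1 hds).2 i (by rw [hds.length_eq]; exact hi) hi
  have h2 := G.outDegree_le hvs hr (vs.get ⟨i, by rw [hds.length_eq]; exact hi⟩)
  have h3 : r < ds[i] := by simpa [Nat.blt_eq] using hlt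
  simp only [List.get_eq_getElem] at h1 h2
  omega

theorem forall₂_outDegree_cons {vs l : List V} {ds : List ℕ} {w : V} (hw : w ∉ vs)
    (hds : List.Forall₂ (fun v k => k ≤ G.outDegree vs v) l ds) :
    List.Forall₂ (fun v k => k ≤ G.outDegree (w :: vs) v) l
      (List.zipWith (fun b k => bif b then Nat.pred k else k) (G.adjBits l w) ds) := by
  induction hds with
  | nil => exact .nil
  | @cons v k l ds hk _ ih =>
    refine .cons ?_ ih
    rw [G.outDegree_cons hw] at hk
    simp only [G.adj_comm v w] at hk
    by_cases h : G.Adj w v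
    · simp [h] at hk ⊢
      omega
    · simpa [h] using hk

/-- The given graph itself traces a branch of the search, which must therefore fail. Only 4-cycles
through a vertex outside `vs` are excluded, so the search may start from a 4-cycle. -/
theorem noExtension_sound {d : ℕ} (hd : ∀ v, d ≤ G.degree v) (r : ℕ) (vs : List V)
    (ds : List ℕ) (hvs : vs.Nodup) (hr : Fintype.card V = vs.length + r)
    (hC : ∀ v ∉ vs, ∀ x y z, ¬ G.IsFourCycle v x y z)
    (hds : List.Forall₂ (fun v k => k ≤ G.outDegree vs v) vs ds) (m : ℕ)
    (h : noExtension d r (m - G.edgesIn vs) (vs.map fun v => bitMask (G.adjBits vs v)) ds = true) :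
    #G.edgeFinset < m := by
  induction r generalizing vs ds with
  | zero =>
    rw [noExtension, G.any_blt_eq_false hvs hr hds, Bool.false_or] at h
    have hall : ∀ v, v ∈ vs := by
      intro v
      have : vs.toFinset = univ := by
        rw [← card_eq_iff_eq_univ, List.toFinset_card_of_nodup hvs, hr]
        rfl
      rw [← List.mem_toFinset, this]
      exact mem_univ v
    rw [G.card_edgeFinset_eq_edgesIn hvs hall]
    have : 0 < m - G.edgesIn vs := by simpa [Nat.blt_eq] using h
    omega
  | succ r ih =>
    rw [noExtension, G.any_blt_eq_false hvs hr hds, Bool.false_or] at h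
    -- The order of naming is free, so the next vertex can be taken adjacent to a vertex that still
    -- lacks neighbours.
    obtain ⟨w, hw, hp⟩ : ∃ w ∉ vs, pivotIndex ds = 0 ∨
        ∃ x, vs[pivotIndex ds - 1]? = some x ∧ decide (G.Adj w x) = true := by
      rcases pivotIndex_spec ds with hp | ⟨k, hk, hk0⟩
      · have : ∃ w, w ∉ vs := by
          by_contra! hall
          have : vs.toFinset = univ := by
            ext v
            simp [hall]
          have h1 := List.toFinset_card_of_nodup hvs
          rw [this, card_univ] at h1
          omega
        obtain ⟨w, hw⟩ := this
        exact ⟨w, hw, .inl hp⟩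
      · rw [List.getElem?_eq_some_iff] at hk
        obtain ⟨hi, rfl⟩ := hk
        have hi' : pivotIndex ds - 1 < vs.length := by rwa [hds.length_eq]
        have h1 := (List.forall₂_iff_get.1 hds).2 _ hi' hi
        simp only [List.get_eq_getElem] at h1
        have h2 : 0 < G.outDegree vs vs[pivotIndex ds - 1] := by omega
        obtain ⟨w, hw⟩ := card_pos.1 h2
        simp only [mem_filter, mem_univ, true_and] at hw
        refine ⟨w, hw.2, .inr ⟨_, List.getElem?_eq_getElem hi', ?_⟩⟩
        simpa using hw.1.symm
    -- Overlapping masks of two neighbours x, y of w give a common neighbour z, and w x z y is a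
    -- forbidden cycle.
    have h' := allSelections_sound _ (fun u => decide (G.Adj w u)) vs 0 _ _ h
      (fun x _ _ => Nat.and_zero _) (hvs.imp_of_mem fun {x y} hx hy hxy sx sy => by
        by_contra h0
        obtain ⟨z, hz, hxz, hyz⟩ := G.exists_common_neighbor h0
        simp only [decide_eq_true_eq] at sx sy
        exact hC w hw x z y ⟨fun e => hw (e ▸ hz), hxy, sx, hxz, hyz.symm, sy.symm⟩) hp
    have hdeg := G.degree_eq_outDegree_add hvs w
    refine ih (w :: vs) ((d - (G.adjBits vs w).count true) :: _) (List.nodup_cons.2 ⟨hw, hvs⟩) (by rw [hr, List.length_cons]; omega)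
      (fun v hv => hC v fun hv' => hv (List.mem_cons_of_mem w hv'))
      (.cons ?_ (G.forall₂_outDegree_cons hw hds)) ?_
    · have h1 := hd w
      have h2 := G.outDegree_cons hw w
      simp only [SimpleGraph.irrefl, if_false] at h2
      omega
    · rw [Nat.sub_sub] at h'
      rw [List.map_cons, map_bitMask_adjBits_cons, adjBits_cons]
      simp only [SimpleGraph.irrefl, decide_false]
      exact h'

end

/-! ### Vertex deletion and upper bounds for the extremal numbers -/

/-- Every graph of order `n` without 4-cycles has size at most `m`. -/
def FourCycleFreeBound (n m : ℕ) : Prop :=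
  ∀ (V : Type) [Fintype V] [DecidableEq V] (G : SimpleGraph V) [DecidableRel G.Adj],
    Fintype.card V = n → (∀ a b c d, ¬ G.IsFourCycle a b c d) → #G.edgeFinset ≤ m

/-- Every two 4-cycles have the same edges. -/
def AtMostOneFourCycle {V : Type*} (G : SimpleGraph V) : Prop :=
  ∀ ⦃a b c d x y z w⦄, G.IsFourCycle a b c d → G.IsFourCycle x y z w →
    s(x, y) = s(a, b) ∨ s(x, y) = s(b, c) ∨ s(x, y) = s(c, d) ∨ s(x, y) = s(d, a)

section

variable {V : Type*} {G : SimpleGraph V} {a b c d x y z w : V}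

theorem IsFourCycle.rotate (h : G.IsFourCycle a b c d) : G.IsFourCycle b c d a :=
  ⟨h.2.1, h.1.symm, h.2.2.2.1, h.2.2.2.2.1, h.2.2.2.2.2, h.2.2.1⟩

theorem IsFourCycle.map {W : Type*} {H : SimpleGraph W} (f : G ↪g H)
    (h : G.IsFourCycle a b c d) : H.IsFourCycle (f a) (f b) (f c) (f d) := by
  obtain ⟨h1, h2, h3, h4, h5, h6⟩ := h
  exact ⟨f.injective.ne h1, f.injective.ne h2, f.map_adj_iff.2 h3, f.map_adj_iff.2 h4,
    f.map_adj_iff.2 h5, f.map_adj_iff.2 h6⟩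

theorem AtMostOneFourCycle.comap {W : Type*} {H : SimpleGraph W} (f : G ↪g H)
    (hH : H.AtMostOneFourCycle) : G.AtMostOneFourCycle := by
  intro a b c d x y z w h1 h2
  have := hH (h1.map f) (h2.map f)
  simpa only [Sym2.eq_iff, f.injective.eq_iff] using this

theorem AtMostOneFourCycle.mem (hG : G.AtMostOneFourCycle) (h : G.IsFourCycle a b c d)
    (h' : G.IsFourCycle x y z w) : x = a ∨ x = b ∨ x = c ∨ x = d := by
  have := hG h h'
  simp only [Sym2.eq_iff] at this
  tauto

end

section

variable {n m : ℕ} {V : Type} [Fintype V] {G : SimpleGraph V} [DecidableRel G.Adj]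

theorem exists_degree_ge (hV : Fintype.card V = n) (k : ℕ)
    (h : k * n < 2 * #G.edgeFinset) : ∃ v, k + 1 ≤ G.degree v := by
  by_contra! hk
  have h1 := G.sum_degrees_eq_twice_card_edges
  have h2 := sum_le_card_nsmul univ (fun v => G.degree v) k fun v _ => Nat.lt_succ_iff.1 (hk v)
  rw [card_univ, hV, smul_eq_mul, mul_comm] at h2
  omega

theorem exists_degree_le (hV : Fintype.card V = n) (k : ℕ)
    (h : 2 * #G.edgeFinset < (k + 1) * n) : ∃ v, G.degree v ≤ k := by
  by_contra! hk
  have h1 := G.sum_degrees_eq_twice_card_edges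
  have h2 := card_nsmul_le_sum univ (fun v => G.degree v) (k + 1) fun v _ => hk v
  rw [card_univ, hV, smul_eq_mul, mul_comm] at h2
  omega

variable [DecidableEq V]

theorem card_edgeFinset_induce_compl_add_degree (G : SimpleGraph V) [DecidableRel G.Adj] (v : V) :
    #(G.induce {v}ᶜ).edgeFinset + G.degree v = #G.edgeFinset := by
  have h1 := G.card_edgeFinset_induce_compl_singleton v
  have h2 := G.card_edgeFinset_deleteIncidenceSet v
  have h3 := G.degree_le_card_edgeFinset v
  have h4 : #(G.induce {v}ᶜ).edgeFinset = #(G.deleteIncidenceSet v).edgeFinset := by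
    convert h1
  omega

theorem card_edgeFinset_le_deleteEdges_add_one (G : SimpleGraph V) [DecidableRel G.Adj]
    (e : Sym2 V) : #G.edgeFinset ≤ #(G.deleteEdges {e}).edgeFinset + 1 := by
  have h : (G.deleteEdges {e}).edgeFinset = G.edgeFinset \ {e} := by
    ext e
    simp [edgeSet_deleteEdges]
  have := le_card_sdiff {e} G.edgeFinset
  rw [h]
  rw [card_singleton] at this
  omega

theorem card_compl_singleton_eq (hV : Fintype.card V = n + 1) (v : V) :
    Fintype.card ({v}ᶜ : Set V) = n := by
  rw [Fintype.card_compl_set, hV]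
  simp

theorem FourCycleFreeBound.card_edgeFinset_le (h : FourCycleFreeBound n m)
    (hV : Fintype.card V = n + 1) (v : V)
    (hv : ∀ a b c d, G.IsFourCycle a b c d → v = a ∨ v = b ∨ v = c ∨ v = d) :
    #G.edgeFinset ≤ m + G.degree v := by
  have := h _ (G.induce {v}ᶜ) (card_compl_singleton_eq hV v) fun a b c d h' => by
    rcases hv _ _ _ _ (h'.map (Embedding.induce _)) with e | e | e | e
    · exact a.2 e.symm
    · exact b.2 e.symm
    · exact c.2 e.symm
    · exact d.2 e.symm
  have := G.card_edgeFinset_induce_compl_add_degree v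
  omega

end

/-- A graph with more than `m + k` edges would have a vertex whose deletion leaves more than `m`
edges. -/
theorem FourCycleFreeBound.succ_of_lt {n m : ℕ} (h : FourCycleFreeBound n m) (hn : 1 ≤ n) (k : ℕ)
    (hk : 2 * (m + k + 1) < (k + 1) * (n + 1)) : FourCycleFreeBound (n + 1) (m + k) := by
  intro V _ _ G _ hV hG
  by_contra! hlt
  -- The surplus `t` is kept because the graph need not have exactly one edge too many; it relaxes
  -- the degree bound equally.
  obtain ⟨t, ht⟩ := Nat.exists_eq_add_of_lt hlt
  obtain ⟨v, hv⟩ := exists_degree_le (G := G) hV (k + t) (by nlinarith)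
  have := h.card_edgeFinset_le hV v fun a b c d h' => (hG a b c d h').elim
  omega

/-- In a counterexample vertex deletion forces minimum degree at least `k + 1`, and averaging gives
a vertex of degree at least `D + 1`, from which the search starts. -/
theorem FourCycleFreeBound.succ_of_noExtension {n m : ℕ} (h : FourCycleFreeBound n m) (k D : ℕ)
    (hD : D * (n + 1) < 2 * (m + k + 1))
    (hs : noExtension (k + 1) n (m + k + 1) [0] [D + 1] = true) :
    FourCycleFreeBound (n + 1) (m + k) := by
  intro V _ _ G _ hV hG
  by_contra! hlt
  obtain ⟨v, hv⟩ := exists_degree_ge (G := G) hV D (by omega)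
  have hdeg : ∀ v, k + 1 ≤ G.degree v := fun v => by
    have := h.card_edgeFinset_le hV v fun a b c d h' => (hG a b c d h').elim
    omega
  have := G.noExtension_sound hdeg n [v] [D + 1] (by simp) (by simp [hV, add_comm])
    (fun _ _ _ _ _ => hG _ _ _ _)
    (.cons (by
      have := G.degree_eq_outDegree_add (List.nodup_singleton v) v
      simp [adjBits] at this
      omega) .nil) (m + k + 1) (by simpa [edgesIn, adjBits, bitMask] using hs)
  omega

theorem fourCycleFreeBound_zero : FourCycleFreeBound 0 0 := by
  intro V _ _ G _ hV _
  have := Fintype.card_eq_zero_iff.1 hV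
  simp [Subsingleton.elim G ⊥]

theorem fourCycleFreeBound_five : FourCycleFreeBound 5 6 :=
  have h1 : FourCycleFreeBound 1 0 :=
    fourCycleFreeBound_zero.succ_of_noExtension 0 0 (by norm_num) (by decide +kernel)
  have h2 : FourCycleFreeBound 2 1 :=
    h1.succ_of_noExtension 1 1 (by norm_num) (by decide +kernel)
  have h3 : FourCycleFreeBound 3 3 := h2.succ_of_lt (by norm_num) 2 (by norm_num)
  have h4 : FourCycleFreeBound 4 4 :=
    h3.succ_of_noExtension 1 2 (by norm_num) (by decide +kernel)
  h4.succ_of_lt (by norm_num) 2 (by norm_num)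

theorem fourCycleFreeBound_six : FourCycleFreeBound 6 7 :=
  fourCycleFreeBound_five.succ_of_noExtension 1 2 (by norm_num) (by decide +kernel)

theorem fourCycleFreeBound_seven : FourCycleFreeBound 7 9 :=
  fourCycleFreeBound_six.succ_of_lt (by norm_num) 2 (by norm_num)

theorem fourCycleFreeBound_eight : FourCycleFreeBound 8 11 :=
  fourCycleFreeBound_seven.succ_of_noExtension 2 2 (by norm_num) (by decide +kernel)

theorem fourCycleFreeBound_nine : FourCycleFreeBound 9 13 :=
  fourCycleFreeBound_eight.succ_of_noExtension 2 3 (by norm_num) (by decide +kernel)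

theorem fourCycleFreeBound_ten : FourCycleFreeBound 10 16 :=
  fourCycleFreeBound_nine.succ_of_lt (by norm_num) 3 (by norm_num)

theorem fourCycleFreeBound_eleven : FourCycleFreeBound 11 18 :=
  fourCycleFreeBound_ten.succ_of_noExtension 2 3 (by norm_num) (by decide +kernel)

theorem fourCycleFreeBound_twelve : FourCycleFreeBound 12 21 :=
  fourCycleFreeBound_eleven.succ_of_lt (by norm_num) 3 (by norm_num)

theorem fourCycleFreeBound_thirteen : FourCycleFreeBound 13 24 :=
  fourCycleFreeBound_twelve.succ_of_lt (by norm_num) 3 (by norm_num)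

/-! ### At most one four-cycle on 12 or 13 vertices -/

theorem noExtension_chordless : noExtension 3 8 18 [10, 5, 10, 5] [2, 2, 2, 2] = true := by
  decide +kernel

/-- The start is the cycle a, b, c, d with chord ac: 5 of the 22 edges are used, and degree at least
4 leaves 1, 2, 1, 2 outside neighbours. Without the chord, 18 edges remain and each cycle vertex
needs 2. -/
theorem noExtension_chord : noExtension 3 8 17 [14, 5, 11, 5] [1, 2, 1, 2] = true := by
  decide +kernel

section

variable {V : Type} [Fintype V] [DecidableEq V] {G : SimpleGraph V} [DecidableRel G.Adj]
  {a b c d : V}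

theorem card_edgeFinset_lt_of_degree (hV : Fintype.card V = 12) (h : G.IsFourCycle a b c d)
    (hbd : ¬ G.Adj b d) (hC : ∀ v ∉ [a, b, c, d], ∀ x y z, ¬ G.IsFourCycle v x y z)
    (h3 : ∀ v, 3 ≤ G.degree v) (h4 : ∀ v ∈ [a, b, c, d], 4 ≤ G.degree v) :
    #G.edgeFinset < 22 := by
  obtain ⟨hac, hbd', h1, h2, h5, h6⟩ := h
  have hnd : [a, b, c, d].Nodup := by
    simp [hac, hbd', h1.ne, h2.ne, h5.ne, h6.ne.symm]
  have hout : ∀ v ∈ [a, b, c, d],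
      4 - (G.adjBits [a, b, c, d] v).count true ≤ G.outDegree [a, b, c, d] v := fun v hv => by
    have := G.degree_eq_outDegree_add hnd v
    have := h4 v hv
    omega
  simp only [List.forall_mem_cons] at hout
  obtain ⟨o1, o2, o3, o4, -⟩ := hout
  by_cases h0 : G.Adj a c
  · refine G.noExtension_sound h3 8 [a, b, c, d] [1, 2, 1, 2] hnd (by simp [hV]) hC
      (.cons ?_ <| .cons ?_ <| .cons ?_ <| .cons ?_ .nil) 22 ?_
    · simpa [adjBits, h0, h1, h6.symm] using o1
    · simpa [adjBits, h1.symm, h2, hbd] using o2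
    · simpa [adjBits, h0.symm, h2.symm, h5] using o3
    · simpa [adjBits, h5.symm, h6, G.adj_comm d b, hbd] using o4
    · simpa [edgesIn, adjBits, bitMask, h0, h0.symm, h1, h1.symm, h2, h2.symm, h5, h5.symm, h6,
        h6.symm, G.adj_comm d b, hbd] using noExtension_chord
  · refine G.noExtension_sound h3 8 [a, b, c, d] [2, 2, 2, 2] hnd (by simp [hV]) hC
      (.cons ?_ <| .cons ?_ <| .cons ?_ <| .cons ?_ .nil) 22 ?_
    · simpa [adjBits, h0, h1, h6.symm] using o1
    · simpa [adjBits, h1.symm, h2, hbd] using o2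
    · simpa [adjBits, G.adj_comm c a, h0, h2.symm, h5] using o3
    · simpa [adjBits, h5.symm, h6, G.adj_comm d b, hbd] using o4
    · simpa [edgesIn, adjBits, bitMask, h0, G.adj_comm c a, h1, h1.symm, h2, h2.symm, h5, h5.symm,
        h6, h6.symm, G.adj_comm d b, hbd] using noExtension_chordless

theorem AtMostOneFourCycle.card_edgeFinset_lt_of_card_eq_twelve (hG : G.AtMostOneFourCycle)
    (hV : Fintype.card V = 12) : #G.edgeFinset < 22 := by
  by_contra! hlt
  by_cases hfree : ∀ a b c d, ¬ G.IsFourCycle a b c d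
  · have := fourCycleFreeBound_twelve V G hV hfree
    omega
  push Not at hfree
  obtain ⟨a, b, c, d, h⟩ := hfree
  -- A cycle vertex lies on every 4-cycle, so its deletion leaves at most 18 of at least 22 edges.
  have h4 : ∀ v ∈ [a, b, c, d], 4 ≤ G.degree v := fun v hv => by
    have := fourCycleFreeBound_eleven.card_edgeFinset_le hV v fun x y z w h' => by
      simp only [List.mem_cons, List.not_mem_nil, or_false] at hv
      have m1 := hG.mem h' h
      have m2 := hG.mem h' h.rotate
      have m3 := hG.mem h' h.rotate.rotate
      have m4 := hG.mem h' h.rotate.rotate.rotate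
      rcases hv with rfl | rfl | rfl | rfl <;> assumption
    omega
  -- Deleting the edge ab destroys the only 4-cycle, at the cost of one edge.
  have h3 : ∀ v, 3 ≤ G.degree v := fun v => by
    have hle : G.deleteEdges {s(a, b)} ≤ G := deleteEdges_le _
    have hb := fourCycleFreeBound_eleven.card_edgeFinset_le (G := G.deleteEdges {s(a, b)}) hV v
      fun x y z w h' => by
        exfalso
        obtain ⟨k1, k2, e1, e2, e3, e4⟩ := h'
        have := hG ⟨k1, k2, hle e1, hle e2, hle e3, hle e4⟩ h
        simp only [deleteEdges_adj, Set.mem_singleton_iff] at e1 e2 e3 e4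
        rcases this with e | e | e | e
        · exact e1.2 e.symm
        · exact e2.2 e.symm
        · exact e3.2 e.symm
        · exact e4.2 e.symm
    have hd := degree_le_of_le hle (v := v)
    have hc := G.card_edgeFinset_le_deleteEdges_add_one s(a, b)
    omega
  have hmem : ∀ v x y z, G.IsFourCycle v x y z → v = a ∨ v = b ∨ v = c ∨ v = d :=
    fun v x y z h' => hG.mem h h'
  by_cases hbd : G.Adj b d
  -- With both diagonals, b d c a would be a second 4-cycle. Rotating then makes ac the missing
  -- diagonal.
  · have hac : ¬ G.Adj c a := by
      intro hac
      have := hG (x := b) (y := d) (z := c) (w := a) h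
        ⟨h.2.2.2.1.ne, h.2.2.2.2.2.ne, hbd, h.2.2.2.2.1.symm, hac, h.2.2.1⟩
      have := h.1
      have := h.2.1
      have := h.2.2.1.ne
      have := h.2.2.2.1.ne
      have := h.2.2.2.2.1.ne
      have := h.2.2.2.2.2.ne
      simp only [Sym2.eq_iff] at *
      grind
    refine hlt.not_gt (card_edgeFinset_lt_of_degree hV h.rotate hac (fun v hv x y z h' => ?_) h3
      fun v hv => h4 v ?_)
    · have := hmem v x y z h'
      simp at hv
      tauto
    · simp at hv ⊢
      tauto
  · refine hlt.not_gt (card_edgeFinset_lt_of_degree hV h hbd (fun v hv x y z h' => ?_) h3 h4)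
    have := hmem v x y z h'
    simp at hv
    tauto

theorem AtMostOneFourCycle.card_edgeFinset_lt_of_card_eq_thirteen (hG : G.AtMostOneFourCycle)
    (hV : Fintype.card V = 13) : #G.edgeFinset < 25 := by
  by_contra! hlt
  obtain ⟨t, ht⟩ := Nat.exists_eq_add_of_le hlt
  -- With 25 + t edges on 13 vertices, deleting v leaves at least 22 edges.
  obtain ⟨v, hv⟩ := exists_degree_le (G := G) hV (t + 3) (by omega)
  have := (hG.comap (Embedding.induce {v}ᶜ)).card_edgeFinset_lt_of_card_eq_twelve
    (card_compl_singleton_eq hV v)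
  have := G.card_edgeFinset_induce_compl_add_degree v
  omega

end

/-! ### Counting copies of the four-cycle -/

section

variable {V : Type*} {G : SimpleGraph V}

theorem Copy.isFourCycle (f : Copy (cycleGraph 4) G) : G.IsFourCycle (f 0) (f 1) (f 2) (f 3) := by
  have h : ∀ i j, (cycleGraph 4).Adj i j → G.Adj (f i) (f j) := fun i j h => f.toHom.map_adj h
  exact ⟨f.injective.ne (by decide), f.injective.ne (by decide), h _ _ (by decide),
    h _ _ (by decide), h _ _ (by decide), h _ _ (by decide)⟩

/-- The copy of `cycleGraph 4` given by a 4-cycle. -/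
def IsFourCycle.toCopy {a b c d : V} (h : G.IsFourCycle a b c d) : Copy (cycleGraph 4) G where
  toHom :=
    { toFun := ![a, b, c, d]
      map_rel' := by
        obtain ⟨-, -, h1, h2, h3, h4⟩ := h
        intro i j hij
        fin_cases i <;> fin_cases j <;> first
          | exact absurd hij (by decide)
          | simp [h1, h2, h3, h4, h1.symm, h2.symm, h3.symm, h4.symm] }
  injective' := by
    obtain ⟨h0, h0', h1, h2, h3, h4⟩ := h
    intro i j hij
    change ![a, b, c, d] i = ![a, b, c, d] j at hij
    fin_cases i <;> fin_cases j <;>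
      simp [h0, h0', h1.ne, h2.ne, h3.ne, h4.ne, h0.symm, h0'.symm, h1.ne', h2.ne', h3.ne',
        h4.ne'] at hij ⊢

theorem cycleGraph_four_free_iff :
    (cycleGraph 4).Free G ↔ ∀ a b c d, ¬ G.IsFourCycle a b c d :=
  ⟨fun h _ _ _ _ h' => h ⟨h'.toCopy⟩, fun h ⟨f⟩ => h _ _ _ _ f.isFourCycle⟩

theorem edgeSet_cycleGraph_four :
    (cycleGraph 4).edgeSet = {s(0, 1), s(1, 2), s(2, 3), s(3, 0)} := by
  ext e
  induction e with
  | h i j =>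
    simp only [mem_edgeSet, Set.mem_insert_iff, Set.mem_singleton_iff]
    revert i j
    decide

theorem Copy.edgeSet_toSubgraph (f : Copy (cycleGraph 4) G) :
    f.toSubgraph.edgeSet = {s(f 0, f 1), s(f 1, f 2), s(f 2, f 3), s(f 3, f 0)} := by
  rw [Copy.toSubgraph, Subgraph.edgeSet_map, Subgraph.edgeSet_top, edgeSet_cycleGraph_four]
  simp [Set.image_insert_eq]

/-- The 4-cycle has no isolated vertices, so the edges of a copy determine its vertices. -/
theorem Copy.toSubgraph_eq_of_edgeSet_eq {f g : Copy (cycleGraph 4) G}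
    (h : f.toSubgraph.edgeSet = g.toSubgraph.edgeSet) : f.toSubgraph = g.toSubgraph := by
  have hv : ∀ (f : Copy (cycleGraph 4) G) (v : V),
      v ∈ f.toSubgraph.verts ↔ ∃ w, f.toSubgraph.Adj v w := by
    have hadj : ∀ i, (cycleGraph 4).Adj i (i + 1) := by decide
    exact fun f v => ⟨fun ⟨i, _, hi⟩ => ⟨f (i + 1), i, i + 1, hadj i, hi, rfl⟩,
      fun ⟨w, hw⟩ => hw.fst_mem⟩
  have ha : ∀ v w, f.toSubgraph.Adj v w ↔ g.toSubgraph.Adj v w := fun v w => by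
    rw [← Subgraph.mem_edgeSet, h, Subgraph.mem_edgeSet]
  refine Subgraph.ext ?_ ?_
  · ext v
    simp_rw [hv, ha]
  · ext v w
    exact ha v w

variable [Fintype V]

theorem atMostOneFourCycle_of_copyCount_le_one (h : G.copyCount (cycleGraph 4) ≤ 1) :
    G.AtMostOneFourCycle := by
  classical
  intro a b c d x y z w h1 h2
  rw [copyCount_eq_card_image_copyToSubgraph, card_le_one] at h
  have := h _ (mem_image_of_mem _ (mem_univ h1.toCopy)) _ (mem_image_of_mem _ (mem_univ h2.toCopy))
  have h3 : s(x, y) ∈ h2.toCopy.toSubgraph.edgeSet := by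
    rw [Copy.edgeSet_toSubgraph]
    exact .inl rfl
  rw [← this, Copy.edgeSet_toSubgraph] at h3
  exact h3

theorem copyCount_cycleGraph_four_le [DecidableEq V] (S : Finset (Finset (Sym2 V)))
    (hS : ∀ a b c d, G.IsFourCycle a b c d → {s(a, b), s(b, c), s(c, d), s(d, a)} ∈ S) :
    G.copyCount (cycleGraph 4) ≤ #S := by
  classical
  rw [copyCount_eq_card_image_copyToSubgraph]
  refine card_le_card_of_injOn (fun H => H.edgeSet.toFinset) ?_ ?_
  · intro H hH
    simp only [coe_image, coe_univ, Set.image_univ, Set.mem_range] at hH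
    obtain ⟨f, rfl⟩ := hH
    have he : f.toSubgraph.edgeSet.toFinset =
        {s(f 0, f 1), s(f 1, f 2), s(f 2, f 3), s(f 3, f 0)} := by
      ext e
      rw [Set.mem_toFinset, Copy.edgeSet_toSubgraph]
      simp
    have := hS _ _ _ _ f.isFourCycle
    rw [← he] at this
    exact this
  · intro H hH H' hH' h
    simp only [coe_image, coe_univ, Set.image_univ, Set.mem_range] at hH hH'
    obtain ⟨f, rfl⟩ := hH
    obtain ⟨g, rfl⟩ := hH'
    exact Copy.toSubgraph_eq_of_edgeSet_eq (Set.toFinset_inj.1 h)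

end

/-! ### Extremal numbers and explicit graphs -/

theorem FourCycleFreeBound.extremalNumber_le {n m : ℕ} (h : FourCycleFreeBound n m) :
    extremalNumber n (cycleGraph 4) ≤ m := by
  rw [← Fintype.card_fin n, extremalNumber_le_iff]
  exact fun G _ hG => h _ G (Fintype.card_fin n) (cycleGraph_four_free_iff.1 hG)

/-- Deleting the edge `e` common to all 4-cycles leaves a C₄-free graph with `m` edges, so the upper
bound is sharp. In `hS` adjacencies alternate with quantifiers so that deciding it discards
non-paths early. -/
theorem FourCycleFreeBound.extremalNumber_eq_and_copyCount_le {n m : ℕ}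
    (h : FourCycleFreeBound n m) (G : SimpleGraph (Fin n)) [DecidableRel G.Adj]
    (hE : G.edgesIn (List.finRange n) = m + 1) (S : Finset (Finset (Sym2 (Fin n))))
    (hS : ∀ a b, G.Adj a b → ∀ c, G.Adj b c → a ≠ c → ∀ d, G.Adj c d → G.Adj d a → b ≠ d →
      {s(a, b), s(b, c), s(c, d), s(d, a)} ∈ S) (e : Sym2 (Fin n)) (he : ∀ T ∈ S, e ∈ T) :
    extremalNumber n (cycleGraph 4) = m ∧ G.edgeSet.ncard = m + 1 ∧
      G.copyCount (cycleGraph 4) ≤ #S := by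
  have hcard : #G.edgeFinset = m + 1 := by
    rw [← hE]
    exact G.card_edgeFinset_eq_edgesIn (List.nodup_finRange n) List.mem_finRange
  have hS' : ∀ a b c d, G.IsFourCycle a b c d → {s(a, b), s(b, c), s(c, d), s(d, a)} ∈ S :=
    fun a b c d ⟨h1, h2, h3, h4, h5, h6⟩ => hS a b h3 c h4 h1 d h5 h6 h2
  refine ⟨h.extremalNumber_le.antisymm ?_, ?_, copyCount_cycleGraph_four_le S hS'⟩
  · have hle : G.deleteEdges {e} ≤ G := deleteEdges_le _
    have hfree : (cycleGraph 4).Free (G.deleteEdges {e}) := by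
      rw [cycleGraph_four_free_iff]
      rintro a b c d ⟨h1, h2, h3, h4, h5, h6⟩
      have := he _ (hS' a b c d ⟨h1, h2, hle h3, hle h4, hle h5, hle h6⟩)
      simp only [deleteEdges_adj, Set.mem_singleton_iff, mem_insert, mem_singleton] at *
      grind
    have h1 := card_edgeFinset_le_extremalNumber hfree
    have h2 := G.card_edgeFinset_le_deleteEdges_add_one e
    rw [Fintype.card_fin] at h1
    omega
  · rw [← coe_edgeFinset, Set.ncard_coe_finset, hcard]

/-- The graph whose `i`-th vertex is adjacent to those earlier vertices `j` for which the `j`-th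
binary digit of the `i`-th entry of the list is one. -/
def ofMasks (ms : List ℕ) (n : ℕ) : SimpleGraph (Fin n) :=
  fromRel fun i j => (ms.getD i 0).testBit j = true

instance (ms : List ℕ) (n : ℕ) : DecidableRel (ofMasks ms n).Adj := fun i j =>
  inferInstanceAs (Decidable (i ≠ j ∧
    ((ms.getD i 0).testBit j = true ∨ (ms.getD j 0).testBit i = true)))

theorem FourCycleFreeBound.exists_copyCount_eq_one {n m : ℕ}
    (h : FourCycleFreeBound n m) (G : SimpleGraph (Fin n)) [DecidableRel G.Adj] (a b c d : Fin n)
    (hE : G.edgesIn (List.finRange n) = m + 1)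
    (hS : ∀ x y, G.Adj x y → ∀ z, G.Adj y z → x ≠ z → ∀ w, G.Adj z w → G.Adj w x → y ≠ w →
      {s(x, y), s(y, z), s(z, w), s(w, x)} ∈
        ({{s(a, b), s(b, c), s(c, d), s(d, a)}} : Finset (Finset (Sym2 (Fin n))))) :
    ∃ G : SimpleGraph (Fin n), G.edgeSet.ncard = extremalNumber n (cycleGraph 4) + 1 ∧
      G.copyCount (cycleGraph 4) = 1 := by
  obtain ⟨h1, h2, h3⟩ := h.extremalNumber_eq_and_copyCount_le G hE _ hS s(a, b) (by simp)
  rw [card_singleton] at h3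
  -- There is at least one copy because the size exceeds the extremal number.
  refine ⟨G, by rw [h1, h2], h3.antisymm (Nat.pos_of_ne_zero fun h0 => ?_)⟩
  have h4 := card_edgeFinset_le_extremalNumber (copyCount_eq_zero.1 h0)
  rw [← coe_edgeFinset, Set.ncard_coe_finset] at h2
  rw [Fintype.card_fin] at h4
  omega

theorem FourCycleFreeBound.isLeast_copyCount_two {n m : ℕ} (h : FourCycleFreeBound n m)
    (h2 : ∀ (G : SimpleGraph (Fin n)) [DecidableRel G.Adj], G.AtMostOneFourCycle →
      #G.edgeFinset < m + 1)
    (G : SimpleGraph (Fin n)) [DecidableRel G.Adj] (S T : Finset (Sym2 (Fin n))) (e : Sym2 (Fin n))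
    (hE : G.edgesIn (List.finRange n) = m + 1)
    (hG : ∀ x y, G.Adj x y → ∀ z, G.Adj y z → x ≠ z → ∀ w, G.Adj z w → G.Adj w x → y ≠ w →
      {s(x, y), s(y, z), s(z, w), s(w, x)} ∈ ({S, T} : Finset (Finset (Sym2 (Fin n)))))
    (heS : e ∈ S) (heT : e ∈ T) :
    IsLeast {c : ℕ | ∃ G : SimpleGraph (Fin n),
      G.edgeSet.ncard = extremalNumber n (cycleGraph 4) + 1 ∧
      G.copyCount (cycleGraph 4) = c} 2 := by
  classical
  obtain ⟨h3, h4, h5⟩ := h.extremalNumber_eq_and_copyCount_le G hE {S, T} hG e (by simp [heS, heT])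
  have hlow : ∀ G : SimpleGraph (Fin n), G.edgeSet.ncard = m + 1 →
      2 ≤ G.copyCount (cycleGraph 4) := fun G hm => by
    by_contra! hlt
    have := h2 G (atMostOneFourCycle_of_copyCount_le_one (Nat.lt_succ_iff.1 hlt))
    rw [← coe_edgeFinset, Set.ncard_coe_finset] at hm
    omega
  rw [h3]
  refine ⟨⟨G, h4, (h5.trans card_le_two).antisymm (hlow G h4)⟩, ?_⟩
  rintro _ ⟨G, hm, rfl⟩
  exact hlow G hm

end SimpleGraph

open SimpleGraph

theorem theorem5 :
    (∀ n : ℕ, 6 ≤ n → n ≤ 11 →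
      ∃ G : SimpleGraph (Fin n),
        G.edgeSet.ncard = SimpleGraph.extremalNumber n (SimpleGraph.cycleGraph 4) + 1 ∧
        G.copyCount (SimpleGraph.cycleGraph 4) = 1) ∧
    (∀ n : ℕ, n = 12 ∨ n = 13 →
      IsLeast {c : ℕ | ∃ G : SimpleGraph (Fin n),
        G.edgeSet.ncard = SimpleGraph.extremalNumber n (SimpleGraph.cycleGraph 4) + 1 ∧
        G.copyCount (SimpleGraph.cycleGraph 4) = c} 2) := by
  constructor
  · intro n h6 h11
    interval_cases n
    · exact fourCycleFreeBound_six.exists_copyCount_eq_one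
        (ofMasks [0, 0, 1, 5, 14, 3] 6) 0 2 4 3 (by decide +kernel) (by decide +kernel)
    · exact fourCycleFreeBound_seven.exists_copyCount_eq_one
        (ofMasks [0, 0, 2, 0, 7, 10, 57] 7) 1 4 6 5 (by decide +kernel) (by decide +kernel)
    · exact fourCycleFreeBound_eight.exists_copyCount_eq_one
        (ofMasks [0, 1, 2, 4, 6, 12, 9, 67] 8) 0 1 7 6 (by decide +kernel) (by decide +kernel)
    · exact fourCycleFreeBound_nine.exists_copyCount_eq_one
        (ofMasks [0, 1, 1, 2, 10, 5, 12, 84, 40] 9) 3 4 7 6 (by decide +kernel) (by decide +kernel)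
    · exact fourCycleFreeBound_ten.exists_copyCount_eq_one
        (ofMasks [0, 0, 2, 0, 14, 25, 8, 37, 196, 67] 10) 2 4 5 7 (by decide +kernel)
        (by decide +kernel)
    · exact fourCycleFreeBound_eleven.exists_copyCount_eq_one
        (ofMasks [0, 0, 1, 4, 0, 24, 33, 18, 142, 149, 67] 11) 2 8 7 9 (by decide +kernel)
        (by decide +kernel)
  · rintro n (rfl | rfl)
    · exact fourCycleFreeBound_twelve.isLeast_copyCount_two
        (fun G _ hG => hG.card_edgeFinset_lt_of_card_eq_twelve (Fintype.card_fin 12))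
        (ofMasks [0, 1, 2, 1, 9, 20, 8, 48, 128, 450, 108, 1284] 12)
        {s(3, 4), s(4, 5), s(5, 10), s(10, 3)} {s(2, 5), s(5, 10), s(10, 11), s(11, 2)} s(5, 10)
        (by decide +kernel) (by decide +kernel) (by decide) (by decide)
    · exact fourCycleFreeBound_thirteen.isLeast_copyCount_two
        (fun G _ hG => hG.card_edgeFinset_lt_of_card_eq_thirteen (Fintype.card_fin 13))
        -- The graph of order 12 plus a vertex joined to 0, 8 and 11, which creates no new 4-cycle.
        (ofMasks [0, 1, 2, 1, 9, 20, 8, 48, 128, 450, 108, 1284, 2305] 13)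
        {s(3, 4), s(4, 5), s(5, 10), s(10, 3)} {s(2, 5), s(5, 10), s(10, 11), s(11, 2)} s(5, 10)
        (by decide +kernel) (by decide +kernel) (by decide) (by decide)
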